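/- Let $R$ be a finite valuation ring, that is, a finite commutative local ring with identity in which every ideal is principal. Let $\pi$ be a generator of its maximal ideal, let $q=|R/(\pi)|$ be the size of its residue field, and let $\ell\ge 1$ be the nilpotency degree of $\pi$, i.e. the smallest positive integer with $\pi^\ell=0$. Assume that $q$ is odd. Let $n\geq 2$, and for $a,b\in R^n$ write $a\cdot b=a_1b_1+\cdots+a_nb_n$. For non-empty $A,B\subseteq R^n$ put $$N_1(A,B)=\big|\{(a,b)\in A\times B: a\cdot b=1\}\big|,\qquad A\cdot B=\{a\cdot b: a\in A,\ b\in B\},\qquad \delta(A)=\frac{|A|}{|R^n|}.$$ Then $$\big|N_1(A,B)-q^{-\ell}|A||B|\big|<q^{(n-1)(\ell-1/2)}\sqrt{|A||B|}.$$ In particular, $1\in A\cdot B$ whenever $\delta(A)\,\delta(B)\geq q^{-(n-1)}$. -/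

import Mathlib

namespace DotProductCount

/-- `N_r(A, B)`: the number of pairs `(a, b)` in `A × B` whose dot product
`a₁ b₁ + ⋯ + aₙ bₙ` equals `r`. -/
noncomputable def solutionCount {R : Type*} [CommRing R] {n : ℕ} (r : R)
    (A B : Set (Fin n → R)) : ℕ :=
  {p : (Fin n → R) × (Fin n → R) | p.1 ∈ A ∧ p.2 ∈ B ∧ dotProduct p.1 p.2 = r}.ncard

/-- `A · B`: the set of all dot products `a · b` with `a ∈ A` and `b ∈ B`. -/
def dotSet {R : Type*} [CommRing R] {n : ℕ} (A B : Set (Fin n → R)) : Set R :=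
  Set.image2 dotProduct A B

/-- `δ(A) = |A| / |Rⁿ|`: the density of a subset `A` of `Rⁿ`. -/
noncomputable def density {R : Type*} {n : ℕ} (A : Set (Fin n → R)) : ℝ :=
  (A.ncard : ℝ) / (Nat.card (Fin n → R) : ℝ)

end DotProductCount

namespace DotProductCount

open Finset

section Fibers

variable {G H : Type*} [AddCommGroup G] [AddCommGroup H] [Fintype G] [Fintype H] [DecidableEq H]

/-! This is a second-moment argument. Write Q = |R|, M = |𝔪|. The error is the sum over b ∈ B of #{a
∈ A : a · b = 1} - |A|/Q. Cauchy–Schwarz, followed by extending the sum of squares to all b, leaves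
a sum of `covKernel` over A × A, so it suffices that each row sums to less than (QM)^(n-1) =
q^((n-1)(2ℓ-1)) (`sum_covKernel_lt`). For a with a unit coordinate, only vectors congruent to a mod
𝔪 can contribute positively (`codegree_mul_card_sq_le`), and the codegrees over that whole class
total exactly (QM)^(n-1) (`sum_codegree_congr`). For other a, the row sum is at most M^n Q^(n-2),
which is smaller since M < Q. -/

/-- All fibers of a surjective homomorphism of finite groups have `|G| / |H|` elements. -/
lemma card_fiber_mul_card (f : G →+ H) (hf : Function.Surjective f) (h : H) :
    #{x | f x = h} * Fintype.card H = Fintype.card G := by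
  classical
  have key : ∀ h' : H, #{x | f x = h'} = #{x | f x = h} := by
    intro h'
    obtain ⟨y, hy⟩ := hf (h - h')
    refine Finset.card_bij' (fun x _ => x + y) (fun x _ => x - y) ?_ ?_ ?_ ?_ <;>
      simp +contextual [hy]
  have := Finset.card_eq_sum_card_fiberwise (f := f) (s := (univ : Finset G))
    (t := (univ : Finset H)) (by simp)
  rw [← Finset.card_univ (α := G), this]
  simp [key, mul_comm]

end Fibers

section LocalRing

variable {R : Type*} [CommRing R] [IsLocalRing R]

lemma exists_isUnit_of_dotProduct_eq_one {ι : Type*} [Fintype ι] {a b : ι → R}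
    (h : a ⬝ᵥ b = 1) : ∃ i, IsUnit (a i) := by
  by_contra! hc
  have : a ⬝ᵥ b ∈ IsLocalRing.maximalIdeal R :=
    Ideal.sum_mem _ fun i _ => Ideal.mul_mem_right _ _ ((IsLocalRing.mem_maximalIdeal _).2 (hc i))
  rw [h, IsLocalRing.mem_maximalIdeal] at this
  exact this isUnit_one

/-- Coordinatewise congruence modulo the maximal ideal. -/
def Congr {ι : Type*} (a a' : ι → R) : Prop :=
  ∀ i, a' i - a i ∈ IsLocalRing.maximalIdeal R

/-! ### Degrees and codegrees of the relation a · b = 1. -/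

variable [Fintype R] {ι : Type*} [Fintype ι] [DecidableEq ι]

open Classical in
/-- The number of `b` with `a · b = 1`. -/
noncomputable def degree (a : ι → R) : ℕ := #{b : ι → R | a ⬝ᵥ b = 1}

open Classical in
/-- The number of `b` with `a · b = a' · b = 1`. -/
noncomputable def codegree (a a' : ι → R) : ℕ := #{b : ι → R | a ⬝ᵥ b = 1 ∧ a' ⬝ᵥ b = 1}

omit [IsLocalRing R] in
lemma degree_mul_card {a : ι → R} (ha : ∃ i, IsUnit (a i)) :
    degree a * Fintype.card R = Fintype.card R ^ Fintype.card ι := by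
  classical
  obtain ⟨i, hi⟩ := ha
  let f : (ι → R) →+ R :=
    { toFun := fun b => a ⬝ᵥ b, map_zero' := by simp, map_add' := by simp [dotProduct_add] }
  have hf : Function.Surjective f := fun y => by
    obtain ⟨u, hu⟩ := hi
    refine ⟨Pi.single i (↑u⁻¹ * y), ?_⟩
    simp [f, ← hu]
  have := card_fiber_mul_card f hf 1
  rw [Fintype.card_fun] at this
  exact this

lemma degree_eq_zero {a : ι → R} (ha : ¬ ∃ i, IsUnit (a i)) : degree a = 0 := by
  classical
  rw [degree, Finset.card_eq_zero, Finset.filter_eq_empty_iff]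
  exact fun b _ hb => ha (exists_isUnit_of_dotProduct_eq_one hb)

lemma codegree_eq_zero_left {a : ι → R} (ha : ¬ ∃ i, IsUnit (a i)) (a' : ι → R) :
    codegree a a' = 0 := by
  classical
  rw [codegree, Finset.card_eq_zero, Finset.filter_eq_empty_iff]
  exact fun b _ hb => ha (exists_isUnit_of_dotProduct_eq_one hb.1)

lemma codegree_eq_zero_right (a : ι → R) {a' : ι → R} (ha : ¬ ∃ i, IsUnit (a' i)) :
    codegree a a' = 0 := by
  classical
  rw [codegree, Finset.card_eq_zero, Finset.filter_eq_empty_iff]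
  exact fun b _ hb => ha (exists_isUnit_of_dotProduct_eq_one hb.2)

/-- A single common solution makes b ↦ (a · b, a' · b) surjective onto R × R, so the solutions form
one of its fibers. Only an inequality holds, as there may be no common solution. -/
lemma codegree_mul_card_sq_le {a a' : ι → R} (h : ¬ Congr a a') :
    codegree a a' * Fintype.card R ^ 2 ≤ Fintype.card R ^ Fintype.card ι := by
  classical
  by_cases hne : ∃ b : ι → R, a ⬝ᵥ b = 1 ∧ a' ⬝ᵥ b = 1
  · obtain ⟨b, hb, hb'⟩ := hne
    have hu : ∃ i, IsUnit (a' i - a i) := by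
      simpa [Congr] using h
    obtain ⟨i, u, hu⟩ := hu
    let f : (ι → R) →+ R × R :=
      { toFun := fun b => (a ⬝ᵥ b, a' ⬝ᵥ b)
        map_zero' := by simp
        map_add' := by simp [dotProduct_add] }
    have hf : Function.Surjective f := by
      rintro ⟨y, z⟩
      set t : R := ↑u⁻¹ * (z - y) with ht
      have h1 : (a' i - a i) * t = z - y := by simp [ht, ← hu]
      -- The single-coordinate shift creates the difference z - y; the multiple of b then moves both
      -- products equally.
      refine ⟨(y - a i * t) • b + Pi.single i t, ?_⟩
      simp only [f, AddMonoidHom.coe_mk, ZeroHom.coe_mk, dotProduct_add, dotProduct_smul, hb, hb',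
        dotProduct_single, smul_eq_mul, Prod.mk.injEq]
      constructor
      · ring
      · linear_combination h1
    have := card_fiber_mul_card f hf (1, 1)
    rw [Fintype.card_fun, Fintype.card_prod] at this
    rw [← this, codegree, sq]
    simp [f]
  · have : codegree a a' = 0 := by
      rw [codegree, Finset.card_eq_zero, Finset.filter_eq_empty_iff]
      exact fun b _ hb => hne ⟨b, hb⟩
    simp [this]

-- Writing a' = a + x with x ∈ 𝔪^n, the condition becomes x · b = 0, and x ↦ x · b maps onto 𝔪
-- because b has a unit coordinate.
open Classical in
lemma card_congr_dotProduct_eq_one {a b : ι → R} (h : a ⬝ᵥ b = 1) :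
    #{a' : ι → R | Congr a a' ∧ a' ⬝ᵥ b = 1} * Fintype.card (IsLocalRing.maximalIdeal R)
      = Fintype.card (IsLocalRing.maximalIdeal R) ^ Fintype.card ι := by
  let f : (ι → IsLocalRing.maximalIdeal R) →+ IsLocalRing.maximalIdeal R :=
    { toFun := fun x => ∑ i, b i • x i
      map_zero' := by simp
      map_add' := by simp [Finset.sum_add_distrib] }
  have hf : Function.Surjective f := fun y => by
    rw [dotProduct_comm] at h
    obtain ⟨i, u, hu⟩ := exists_isUnit_of_dotProduct_eq_one h
    refine ⟨Pi.single i ((↑u⁻¹ : R) • y), ?_⟩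
    simp only [f, AddMonoidHom.coe_mk, ZeroHom.coe_mk]
    rw [Finset.sum_eq_single i (by simp +contextual) (by simp), Pi.single_eq_same, smul_smul, ← hu]
    simp
  have := card_fiber_mul_card f hf 0
  rw [Fintype.card_fun] at this
  rw [← this]
  congr 1
  have hval : ∀ x, ((f x : IsLocalRing.maximalIdeal R) : R) = (fun i => (x i : R)) ⬝ᵥ b := by
    intro x
    simp [f, dotProduct, mul_comm]
  symm
  refine Finset.card_bij (fun x _ => a + fun i => (x i : R)) ?_ ?_ ?_
  · intro x hx
    rw [Finset.mem_filter] at hx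
    have h0 := hval x
    rw [hx.2] at h0
    simp only [Finset.mem_filter, Finset.mem_univ, true_and, add_dotProduct, h, ← h0]
    exact ⟨fun i => by simp, by simp⟩
  · intro x _ y _ hxy
    funext i
    simpa using congrFun hxy i
  · intro a' ha'
    simp only [Finset.mem_filter, Finset.mem_univ, true_and] at ha'
    refine ⟨fun i => ⟨a' i - a i, ha'.1 i⟩, ?_, ?_⟩
    · simp only [Finset.mem_filter, Finset.mem_univ, true_and]
      apply Subtype.ext
      rw [hval]
      change (a' - a) ⬝ᵥ b = 0
      rw [sub_dotProduct, h, ha'.2, sub_self]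
    · funext i
      simp

open Classical in
lemma sum_codegree_congr (a : ι → R) :
    (∑ a' with Congr a a', codegree a a') * Fintype.card (IsLocalRing.maximalIdeal R)
      = degree a * Fintype.card (IsLocalRing.maximalIdeal R) ^ Fintype.card ι := by
  have h1 : ∑ a' with Congr a a', codegree a a'
      = ∑ b with a ⬝ᵥ b = 1, #{a' : ι → R | Congr a a' ∧ a' ⬝ᵥ b = 1} := by
    simp only [codegree, ← Finset.filter_filter]
    exact Finset.sum_card_bipartiteAbove_eq_sum_card_bipartiteBelow (fun a' b => a' ⬝ᵥ b = 1)
  rw [h1, Finset.sum_mul, Finset.sum_congr rfl (fun b hb =>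
    card_congr_dotProduct_eq_one (Finset.mem_filter.1 hb).2)]
  simp [degree]

/-! ### Cardinalities of R and of its ideals. -/

open Classical in
variable (R) in
lemma card_eq_card_residueField_mul :
    Fintype.card R
      = Nat.card (IsLocalRing.ResidueField R) * Fintype.card (IsLocalRing.maximalIdeal R) := by
  rw [← Nat.card_eq_fintype_card, ← Nat.card_eq_fintype_card,
    Submodule.card_eq_card_quotient_mul_card (IsLocalRing.maximalIdeal R), mul_comm]
  rfl

open Classical in
lemma card_nonunimodular :
    #{a : ι → R | ¬ ∃ i, IsUnit (a i)}
      = Fintype.card (IsLocalRing.maximalIdeal R) ^ Fintype.card ι := by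
  rw [← Fintype.card_fun]
  symm
  refine Finset.card_bij (fun x _ i => (x i : R)) ?_ ?_ ?_
  · intro x _
    simp only [Finset.mem_filter, Finset.mem_univ, true_and, not_exists]
    exact fun i => (IsLocalRing.mem_maximalIdeal _).1 (x i).2
  · intro x _ y _ hxy
    funext i
    simpa using congrFun hxy i
  · intro a ha
    exact ⟨fun i => ⟨a i, by simpa using fun h => (Finset.mem_filter.1 ha).2 ⟨i, h⟩⟩, by simp, rfl⟩

-- The map (r, j) ↦ r π^k + j from R × (π^(k+1)) onto (π^k) has kernel in bijection with 𝔪: a unit r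
-- in the kernel would force π^k = 0.
open Classical in
lemma card_span_pow {π : R} (hπ : IsLocalRing.maximalIdeal R = Ideal.span {π}) {k : ℕ}
    (hk : π ^ k ≠ 0) :
    Fintype.card (Ideal.span {π ^ k})
      = Nat.card (IsLocalRing.ResidueField R) * Fintype.card (Ideal.span {π ^ (k + 1)}) := by
  have hle : Ideal.span {π ^ (k + 1)} ≤ Ideal.span {π ^ k} :=
    Ideal.span_singleton_le_span_singleton.2 ⟨π, pow_succ π k⟩
  let g : R →+ Ideal.span {π ^ k} :=
    { toFun := fun r => r • ⟨π ^ k, Ideal.mem_span_singleton_self _⟩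
      map_zero' := by simp
      map_add' := by simp [add_smul] }
  let f : R × Ideal.span {π ^ (k + 1)} →+ Ideal.span {π ^ k} :=
    g.coprod (Submodule.inclusion hle).toAddMonoidHom
  have hval : ∀ p, (f p : R) = p.1 * π ^ k + p.2 := fun p => by simp [f, g]
  have hf : Function.Surjective f := by
    rintro ⟨y, hy⟩
    obtain ⟨r, rfl⟩ := Ideal.mem_span_singleton'.1 hy
    exact ⟨(r, 0), Subtype.ext (by simp [hval])⟩
  have hcard := card_fiber_mul_card f hf 0
  have hker : #{p | f p = 0} = Fintype.card (IsLocalRing.maximalIdeal R) := by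
    symm
    have hmem : ∀ r ∈ IsLocalRing.maximalIdeal R, -(r * π ^ k) ∈ Ideal.span {π ^ (k + 1)} := by
      intro r hr
      rw [hπ, Ideal.mem_span_singleton'] at hr
      obtain ⟨s, rfl⟩ := hr
      exact Ideal.mem_span_singleton'.2 ⟨-s, by ring⟩
    refine Finset.card_bij
      (fun (r : IsLocalRing.maximalIdeal R) _ => ((r : R), ⟨-(r * π ^ k), hmem r r.2⟩)) ?_ ?_ ?_
    · intro r _
      simp only [Finset.mem_filter, Finset.mem_univ, true_and]
      exact Subtype.ext (by simp [hval])
    · intro r _ s _ h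
      exact Subtype.ext (Prod.ext_iff.1 h).1
    · rintro ⟨r, j, hj⟩ h
      simp only [Finset.mem_filter, Finset.mem_univ, true_and] at h
      have h0 := hval (r, ⟨j, hj⟩)
      rw [h] at h0
      simp only [ZeroMemClass.coe_zero] at h0
      obtain ⟨s, rfl⟩ := Ideal.mem_span_singleton'.1 hj
      have hr : r ∈ IsLocalRing.maximalIdeal R := by
        have h1 : (r + s * π) * π ^ k = 0 := by rw [h0]; ring
        have h2 : r + s * π ∈ IsLocalRing.maximalIdeal R := by
          rw [IsLocalRing.mem_maximalIdeal]
          exact fun hu => hk (hu.mul_right_eq_zero.1 h1)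
        have h3 : s * π ∈ IsLocalRing.maximalIdeal R := by
          rw [hπ]; exact Ideal.mem_span_singleton'.2 ⟨s, rfl⟩
        simpa using sub_mem h2 h3
      refine ⟨⟨r, hr⟩, Finset.mem_univ _, ?_⟩
      refine Prod.ext rfl (Subtype.ext ?_)
      change -(r * π ^ k) = s * π ^ (k + 1)
      linear_combination h0
  rw [hker, Fintype.card_prod, card_eq_card_residueField_mul R] at hcard
  have hpos : 0 < Fintype.card (IsLocalRing.maximalIdeal R) := Fintype.card_pos
  apply Nat.eq_of_mul_eq_mul_left hpos
  rw [hcard]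
  ring

lemma card_eq_residueField_pow_nilpotencyClass {π : R}
    (hπ : IsLocalRing.maximalIdeal R = Ideal.span {π}) :
    Fintype.card R = Nat.card (IsLocalRing.ResidueField R) ^ nilpotencyClass π := by
  classical
  have hmem : π ∈ IsLocalRing.maximalIdeal R := hπ ▸ Ideal.mem_span_singleton_self π
  have hnil : IsNilpotent π := by
    obtain ⟨k, hk⟩ := IsArtinianRing.isNilpotent_jacobson_bot (R := R)
    refine ⟨k, ?_⟩
    have := Ideal.pow_mem_pow hmem k
    rw [← IsLocalRing.jacobson_eq_maximalIdeal ⊥ bot_ne_top, hk] at this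
    simpa using this
  have key : ∀ k ≤ nilpotencyClass π, Fintype.card R
      = Nat.card (IsLocalRing.ResidueField R) ^ k * Fintype.card (Ideal.span {π ^ k}) := by
    intro k
    induction k with
    | zero =>
      intro _
      rw [pow_zero, one_mul, ← Nat.card_eq_fintype_card, ← Nat.card_eq_fintype_card, pow_zero,
        Ideal.span_singleton_one]
      exact (Nat.card_congr Submodule.topEquiv.toEquiv).symm
    | succ k ih =>
      intro hk
      have hne : π ^ k ≠ 0 := fun h => by
        have : nilpotencyClass π ≤ k := Nat.sInf_le h
        omega
      rw [ih (by omega), card_span_pow hπ hne, pow_succ]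
      ring
  rw [key _ le_rfl, ← Nat.card_eq_fintype_card, pow_nilpotencyClass hnil]
  simp

/-! ### Second moment and row-sum bound. -/

/-- The covariance kernel of the incidence matrix of `a · b = 1` centred at its mean `1 / |R|`. -/
noncomputable def covKernel (a a' : ι → R) : ℝ :=
  codegree a a' - (degree a + degree a') / (Fintype.card R : ℝ)
    + (Fintype.card R : ℝ) ^ Fintype.card ι / (Fintype.card R : ℝ) ^ 2

omit [IsLocalRing R] in
open Classical in
lemma sum_sq_eq_sum_covKernel (A : Finset (ι → R)) :
    ∑ b : ι → R, ((#{a ∈ A | a ⬝ᵥ b = 1} : ℝ) - #A / (Fintype.card R : ℝ)) ^ 2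
      = ∑ a ∈ A, ∑ a' ∈ A, covKernel a a' := by
  set Q : ℝ := (Fintype.card R : ℝ) with hQ
  have hb : ∀ b : ι → R, ((#{a ∈ A | a ⬝ᵥ b = 1} : ℝ) - #A / Q) ^ 2
      = ∑ a ∈ A, ∑ a' ∈ A,
        ((if a ⬝ᵥ b = 1 then (1 : ℝ) else 0) - 1 / Q)
          * ((if a' ⬝ᵥ b = 1 then (1 : ℝ) else 0) - 1 / Q) := by
    intro b
    rw [← Finset.sum_mul_sum, ← sq, Finset.sum_sub_distrib]
    simp [Finset.sum_boole, div_eq_mul_inv]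
  simp_rw [hb]
  rw [Finset.sum_comm]
  refine Finset.sum_congr rfl fun a _ => ?_
  rw [Finset.sum_comm]
  refine Finset.sum_congr rfl fun a' _ => ?_
  have h1 : ∀ b : ι → R, ((if a ⬝ᵥ b = 1 then (1 : ℝ) else 0) - 1 / Q)
          * ((if a' ⬝ᵥ b = 1 then (1 : ℝ) else 0) - 1 / Q)
      = (if a ⬝ᵥ b = 1 ∧ a' ⬝ᵥ b = 1 then (1 : ℝ) else 0)
        - ((if a ⬝ᵥ b = 1 then (1 : ℝ) else 0) + (if a' ⬝ᵥ b = 1 then (1 : ℝ) else 0)) / Q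
        + 1 / Q ^ 2 := by
    intro b
    by_cases h : a ⬝ᵥ b = 1 <;> by_cases h' : a' ⬝ᵥ b = 1 <;> simp [h, h'] <;> ring
  simp_rw [h1]
  rw [Finset.sum_add_distrib, Finset.sum_sub_distrib, ← Finset.sum_div, Finset.sum_add_distrib]
  simp only [Finset.sum_boole, Finset.sum_const, Finset.card_univ, Fintype.card_fun, covKernel,
    degree, codegree, nsmul_eq_mul, Nat.cast_pow, ← hQ]
  ring

open Classical in
/-- Every row of the covariance kernel has sum less than `(|R| |𝔪|) ^ (n - 1)`. -/
lemma sum_covKernel_lt {k : ℕ} (hι : Fintype.card ι = k + 2) (A : Finset (ι → R)) {a : ι → R}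
    (ha : a ∈ A) :
    ∑ a' ∈ A, covKernel a a'
      < ((Fintype.card R : ℝ) * Fintype.card (IsLocalRing.maximalIdeal R)) ^ (k + 1) := by
  have hQM : Fintype.card (IsLocalRing.maximalIdeal R) < Fintype.card R :=
    Fintype.card_subtype_lt (x := (1 : R)) (by simp)
  have hM0 : 0 < Fintype.card (IsLocalRing.maximalIdeal R) := Fintype.card_pos
  have hsum := sum_codegree_congr a
  have hnon := card_nonunimodular (R := R) (ι := ι)
  have hdeg : ∀ x : ι → R, (∃ i, IsUnit (x i)) →
      (degree x : ℝ) = (Fintype.card R : ℝ) ^ (k + 1) := by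
    intro x hx
    have := degree_mul_card hx
    rw [hι, pow_succ] at this
    exact_mod_cast Nat.eq_of_mul_eq_mul_right (by omega) this
  have hcod : ∀ x y : ι → R, ¬ Congr x y →
      (codegree x y : ℝ) ≤ (Fintype.card R : ℝ) ^ k := by
    intro x y hxy
    have := codegree_mul_card_sq_le hxy
    rw [hι, pow_add] at this
    exact_mod_cast Nat.le_of_mul_le_mul_right this (by positivity)
  rw [hι] at hsum hnon
  simp only [covKernel, hι]
  generalize Fintype.card R = Q at *
  generalize Fintype.card (IsLocalRing.maximalIdeal R) = M at *
  have hQ : (0 : ℝ) < Q := by exact_mod_cast (by omega : 0 < Q)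
  have hM : (0 : ℝ) < M := by exact_mod_cast hM0
  have hd0 : ∀ x : ι → R, (¬ ∃ i, IsUnit (x i)) → (degree x : ℝ) = 0 := fun x hx => by
    rw [degree_eq_zero hx, Nat.cast_zero]
  by_cases hu : ∃ i, IsUnit (a i)
  · have hs : (∑ a' with Congr a a', (codegree a a' : ℝ)) = (Q * M : ℝ) ^ (k + 1) := by
      have : (∑ a' with Congr a a', (codegree a a' : ℝ)) * M = degree a * (M : ℝ) ^ (k + 2) := by
        exact_mod_cast hsum
      rw [hdeg a hu] at this
      apply mul_right_cancel₀ hM.ne'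
      rw [this]; ring
    have hterm : ∀ a' ∈ A, (codegree a a' - (degree a + degree a') / Q + Q ^ (k + 2) / Q ^ 2 : ℝ)
        ≤ if Congr a a' then (codegree a a' : ℝ) - Q ^ k else 0 := by
      intro a' _
      rw [hdeg a hu]
      by_cases hu' : ∃ i, IsUnit (a' i)
      · rw [hdeg a' hu']
        have e : (codegree a a' - (Q ^ (k + 1) + Q ^ (k + 1)) / Q + Q ^ (k + 2) / Q ^ 2 : ℝ)
          = codegree a a' - Q ^ k := by field_simp; ring
        rw [e]
        split_ifs with h
        · exact le_rfl
        · linarith [hcod a a' h]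
      · have hnc : ¬ Congr a a' := by
          intro hc
          obtain ⟨i, hi⟩ := hu
          refine hu' ⟨i, ?_⟩
          by_contra hni
          have h1 := sub_mem ((IsLocalRing.mem_maximalIdeal _).2 hni) (hc i)
          rw [sub_sub_cancel, IsLocalRing.mem_maximalIdeal] at h1
          exact h1 hi
        -- The kernel vanishes exactly here: -Q^(k+1)/Q + Q^k = 0.
        rw [if_neg hnc, hd0 a' hu', codegree_eq_zero_right a hu']
        apply le_of_eq
        field_simp
        ring
    calc _ ≤ ∑ a' ∈ A, if Congr a a' then (codegree a a' : ℝ) - Q ^ k else 0 :=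
          Finset.sum_le_sum hterm
      -- Strictness comes from the diagonal term a' = a, which drops a positive Q^k.
      _ < ∑ a' ∈ A, if Congr a a' then (codegree a a' : ℝ) else 0 := by
          refine Finset.sum_lt_sum (fun a' _ => ?_) ⟨a, ha, ?_⟩
          · split_ifs
            · have : (0 : ℝ) ≤ Q ^ k := by positivity
              linarith
            · exact le_rfl
          · have : (0 : ℝ) < Q ^ k := by positivity
            have hc : Congr a a := fun i => by simp
            rw [if_pos hc, if_pos hc]
            linarith
      _ ≤ ∑ a', if Congr a a' then (codegree a a' : ℝ) else 0 :=
          Finset.sum_le_sum_of_subset_of_nonneg (Finset.subset_univ _) fun a' _ _ => by positivity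
      _ = _ := by rw [← Finset.sum_filter, hs]
  · have hterm : ∀ a' ∈ A, (codegree a a' - (degree a + degree a') / Q + Q ^ (k + 2) / Q ^ 2 : ℝ)
        = if ¬ ∃ i, IsUnit (a' i) then (Q : ℝ) ^ k else 0 := by
      intro a' _
      rw [hd0 a hu, codegree_eq_zero_left hu]
      by_cases hu' : ∃ i, IsUnit (a' i)
      · rw [hdeg a' hu', if_neg (not_not.2 hu')]
        field_simp
        ring
      · rw [hd0 a' hu', if_pos hu']
        field_simp
        ring
    have hQM' : (M : ℝ) < Q := by exact_mod_cast hQM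
    calc _ = ∑ a' ∈ A, if ¬ ∃ i, IsUnit (a' i) then (Q : ℝ) ^ k else 0 :=
          Finset.sum_congr rfl hterm
      _ ≤ ∑ a' : ι → R, if ¬ ∃ i, IsUnit (a' i) then (Q : ℝ) ^ k else 0 :=
          Finset.sum_le_sum_of_subset_of_nonneg (Finset.subset_univ _) fun a' _ _ => by positivity
      _ = (M : ℝ) ^ (k + 2) * Q ^ k := by
          rw [← Finset.sum_filter, Finset.sum_const, hnon, nsmul_eq_mul, Nat.cast_pow]
      _ = (Q * M) ^ k * M * M := by ring
      _ < (Q * M) ^ k * M * Q := by gcongr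
      _ = _ := by ring

open Classical in
lemma abs_card_sub_lt {k : ℕ} (hι : Fintype.card ι = k + 2) {A B : Finset (ι → R)}
    (hA : A.Nonempty) (hB : B.Nonempty) :
    |(#{p ∈ A ×ˢ B | p.1 ⬝ᵥ p.2 = 1} : ℝ) - #A * #B / Fintype.card R|
      < √(((Fintype.card R : ℝ) * Fintype.card (IsLocalRing.maximalIdeal R)) ^ (k + 1)
        * (#A * #B)) := by
  set Q : ℝ := (Fintype.card R : ℝ)
  set T : ℝ := (Q * Fintype.card (IsLocalRing.maximalIdeal R)) ^ (k + 1)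
  have hsplit : (#{p ∈ A ×ˢ B | p.1 ⬝ᵥ p.2 = 1} : ℝ) - #A * #B / Q
      = ∑ b ∈ B, ((#{a ∈ A | a ⬝ᵥ b = 1} : ℝ) - #A / Q) := by
    rw [Finset.sum_sub_distrib, Finset.sum_const, nsmul_eq_mul, Finset.card_filter,
      Finset.sum_product_right]
    simp only [← Finset.card_filter]
    push_cast
    ring
  have hlt : ∑ b : ι → R, ((#{a ∈ A | a ⬝ᵥ b = 1} : ℝ) - #A / Q) ^ 2 < #A * T := by
    rw [sum_sq_eq_sum_covKernel, ← nsmul_eq_mul, ← Finset.sum_const]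
    exact Finset.sum_lt_sum_of_nonempty hA fun a ha => sum_covKernel_lt hι A ha
  have hBpos : (0 : ℝ) < #B := by exact_mod_cast hB.card_pos
  rw [hsplit]
  apply Real.lt_sqrt_of_sq_lt
  rw [sq_abs]
  calc _ ≤ #B * ∑ b ∈ B, ((#{a ∈ A | a ⬝ᵥ b = 1} : ℝ) - #A / Q) ^ 2 := sq_sum_le_card_mul_sum_sq
    _ ≤ #B * ∑ b : ι → R, ((#{a ∈ A | a ⬝ᵥ b = 1} : ℝ) - #A / Q) ^ 2 := by
        gcongr
        exact Finset.subset_univ _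
    _ < #B * (#A * T) := by gcongr
    _ = _ := by ring

end LocalRing

end DotProductCount

/-! ### Translation into powers of q, and the density threshold. -/

theorem mainTheorem4 {R : Type*} [CommRing R] [Finite R] [IsLocalRing R]
    [IsPrincipalIdealRing R]
    (π : R) (hπ : IsLocalRing.maximalIdeal R = Ideal.span {π})
    (q : ℕ) (hq : q = Nat.card (IsLocalRing.ResidueField R)) (hq_odd : Odd q)
    (l : ℕ) (hl : l = nilpotencyClass π)
    (n : ℕ) (hn : 2 ≤ n)
    (A B : Set (Fin n → R)) (hA : A.Nonempty) (hB : B.Nonempty) :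
    |(DotProductCount.solutionCount 1 A B : ℝ)
          - (q : ℝ) ^ (-(l : ℝ)) * (A.ncard : ℝ) * (B.ncard : ℝ)|
        < (q : ℝ) ^ (((n : ℝ) - 1) * ((l : ℝ) - 1 / 2))
          * Real.sqrt ((A.ncard : ℝ) * (B.ncard : ℝ)) ∧
    (DotProductCount.density A * DotProductCount.density B ≥ (q : ℝ) ^ (-((n : ℝ) - 1)) →
      (1 : R) ∈ DotProductCount.dotSet A B) := by
  classical
  have := Fintype.ofFinite R
  obtain ⟨k, rfl⟩ : ∃ k, n = k + 2 := ⟨n - 2, by omega⟩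
  have hcard := DotProductCount.card_eq_residueField_pow_nilpotencyClass hπ
  rw [← hl, ← hq] at hcard
  have hres := DotProductCount.card_eq_card_residueField_mul R
  rw [← hq] at hres
  have hq0 : 0 < q := hq_odd.pos
  have hqR : (0 : ℝ) < q := by exact_mod_cast hq0
  have hprod : ((Fintype.card R : ℝ) * Fintype.card (IsLocalRing.maximalIdeal R))
      = (q : ℝ) ^ (2 * (l : ℝ) - 1) := by
    apply mul_left_cancel₀ hqR.ne'
    have h1 : (q : ℝ) * Fintype.card (IsLocalRing.maximalIdeal R) = (q : ℝ) ^ l := by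
      exact_mod_cast hres.symm.trans hcard
    rw [mul_left_comm, h1, hcard, Real.rpow_sub_one hqR.ne', mul_div_cancel₀ _ hqR.ne',
      Nat.cast_pow, two_mul, Real.rpow_add hqR, Real.rpow_natCast]
  have hsqrt : √(((Fintype.card R : ℝ) * Fintype.card (IsLocalRing.maximalIdeal R)) ^ (k + 1))
      = (q : ℝ) ^ ((((k + 2 : ℕ) : ℝ) - 1) * ((l : ℝ) - 1 / 2)) := by
    rw [hprod, ← Real.rpow_natCast, ← Real.rpow_mul hqR.le, Real.sqrt_eq_rpow,
      ← Real.rpow_mul hqR.le]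
    congr 1
    push_cast
    ring
  have hinv : (q : ℝ) ^ (-(l : ℝ)) = (Fintype.card R : ℝ)⁻¹ := by
    rw [Real.rpow_neg hqR.le, Real.rpow_natCast, hcard, Nat.cast_pow]
  have hcount : DotProductCount.solutionCount 1 A B
      = ((A.toFinset ×ˢ B.toFinset).filter fun p => dotProduct p.1 p.2 = 1).card := by
    rw [DotProductCount.solutionCount, ← Set.ncard_coe_finset]
    congr 1
    ext p
    simp [and_assoc]
  have hmain : |(DotProductCount.solutionCount 1 A B : ℝ)
          - (q : ℝ) ^ (-(l : ℝ)) * (A.ncard : ℝ) * (B.ncard : ℝ)|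
        < (q : ℝ) ^ ((((k + 2 : ℕ) : ℝ) - 1) * ((l : ℝ) - 1 / 2))
          * Real.sqrt ((A.ncard : ℝ) * (B.ncard : ℝ)) := by
    have h := DotProductCount.abs_card_sub_lt (R := R) (ι := Fin (k + 2)) (k := k) (by simp)
      (Set.toFinset_nonempty.2 hA) (Set.toFinset_nonempty.2 hB)
    rw [Real.sqrt_mul (by positivity), hsqrt, ← hcount] at h
    rw [Set.ncard_eq_toFinset_card', Set.ncard_eq_toFinset_card', hinv]
    convert h using 3
    ring
  refine ⟨hmain, fun hδ => ?_⟩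
  -- The density hypothesis says precisely that the main term is at least the error bound;
  -- strictness of that bound covers equality.
  have hpos : 0 < DotProductCount.solutionCount 1 A B := by
    set α : ℝ := (A.ncard : ℝ) * (B.ncard : ℝ) with hα
    have hα0 : 0 ≤ α := by positivity
    set e : ℝ := ((k + 2 : ℕ) : ℝ) - 1 with he
    set Q : ℝ := (Fintype.card R : ℝ) with hQdef
    have hQ : Q = (q : ℝ) ^ (l : ℝ) := by rw [hQdef, hcard, Nat.cast_pow, Real.rpow_natCast]
    have hQ0 : 0 < Q := hQ ▸ Real.rpow_pos_of_pos hqR _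
    have hcardV : (Nat.card (Fin (k + 2) → R) : ℝ) = Q ^ (k + 2) := by simp [hQdef]
    have hα1 : Q ^ (k + 2) * Q ^ (k + 2) * (q : ℝ) ^ (-e) ≤ α := by
      rw [DotProductCount.density, DotProductCount.density, hcardV, div_mul_div_comm, ge_iff_le,
        le_div_iff₀ (by positivity)] at hδ
      linarith
    have hroot : (q : ℝ) ^ ((l : ℝ) * (k + 2) - e / 2) ≤ √α := by
      apply Real.le_sqrt_of_sq_le
      refine le_trans (le_of_eq ?_) hα1
      rw [hQ, ← Real.rpow_natCast, ← Real.rpow_natCast, ← Real.rpow_mul hqR.le,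
        ← Real.rpow_mul hqR.le, ← Real.rpow_add hqR, ← Real.rpow_add hqR]
      congr 1
      push_cast
      ring
    have hlow : (q : ℝ) ^ (e * ((l : ℝ) - 1 / 2)) * √α ≤ (q : ℝ) ^ (-(l : ℝ)) * α := by
      calc _ = (q : ℝ) ^ (-(l : ℝ)) * ((q : ℝ) ^ ((l : ℝ) * (k + 2) - e / 2) * √α) := by
            rw [← mul_assoc, ← Real.rpow_add hqR]
            congr 2
            rw [he]
            push_cast
            ring
        _ ≤ (q : ℝ) ^ (-(l : ℝ)) * (√α * √α) := by gcongr
        _ = _ := by rw [Real.mul_self_sqrt hα0]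
    have := (abs_lt.1 hmain).1
    rw [mul_assoc, ← hα] at this
    have h0 : (0 : ℝ) < DotProductCount.solutionCount 1 A B := by linarith
    exact_mod_cast h0
  obtain ⟨p, hp⟩ := Set.nonempty_of_ncard_ne_zero hpos.ne'
  exact ⟨p.1, hp.1, p.2, hp.2.1, hp.2.2⟩
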